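/- Everything is of class $C^\infty$. Let $M$ be an $n$-dimensional (Hausdorff) manifold with a $p$-dimensional foliation $\mathcal F$, let $T\mathcal F\subseteq TM$ be its tangent bundle and $\nu^*\mathcal F\subseteq T^*M$ the annihilator of $T\mathcal F$. On an open set $U\subseteq M$, a $1$-form $\alpha$ is called foliated if $i(V)\alpha=0$ and $i(V)d\alpha=0$ for all vector fields $V$ on $U$ tangent to $\mathcal F$, and a vector field $X$ is called foliated if $[X,V]$ is tangent to $\mathcal F$ for all such $V$. A hamiltonian structure of $\mathcal F$ is a vector bundle morphism $h:\nu^*\mathcal F\to TM$ whose induced map $H$ on sections satisfies, for every open $U\subseteq M$ and all foliated $1$-forms $\alpha,\beta,\gamma$ on $U$: $H\alpha$ is a foliated vector field, $\langle\alpha,H\beta\rangle=-\langle\beta,H\alpha\rangle$, and $$[H,H](\alpha,\beta,\gamma):=2\sum_{\mathrm{Cycl}(\alpha,\beta,\gamma)}\langle H L_{H\alpha}\beta,\gamma\rangle=0 .$$ Let $E$ be a differentiable distribution with $E\oplus T\mathcal F=TM$, and let $p_E:TM\to E$ be the projection along $T\mathcal F$. The hamiltonian structure $h$ is tame with image extension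 $E$ if $\operatorname{im}h\subseteq E$ and if $[X,Y]$ is a section of $E$ for all vector fields $X,Y$ on $M$ with values in $\operatorname{im}h$. For $f\in C^\infty(M)$ put $d'f:=df\circ p_E$, a section of $\nu^*\mathcal F$, and define the extended bracket of $f,g\in C^\infty(M)$ by $$\{f,g\}':=\langle H d'f,dg\rangle .$$ **Proposition.** Let $h$ be a tame hamiltonian structure of $\mathcal F$ with image extension $E$. Then $\{\cdot,\cdot\}'$ is a Poisson structure on $M$: it is an $\mathbb R$-bilinear, skew-symmetric bracket $C^\infty(M)\times C^\infty(M)\to C^\infty(M)$ which satisfies the Leibniz rule and the Jacobi identity. Consequently there is a Poisson bivector field $P$ on $M$ with $P(df,dg)=\{f,g\}'$ for all $f,g\in C^\infty(M)$, and such that the map $\sharp_P:T^*M\to TM$, $\langle\sharp_P\alpha,\beta\rangle=P(\alpha,\beta)$, satisfies $\sharp_P|_{E^*}=h$ and $\sharp_P|_{T^*\mathcal F}=0$, where $E^*\cong\nu^*\mathcal F$ is the annihilator of $T\mathcal F$ and $T^*\mathcal F$ is the annihilator of $E$. -/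

import Mathlib

open scoped Manifold ContDiff Topology

noncomputable section

namespace HamFol

/-- The cotangent space at `x` of a manifold modelled on `ℝⁿ`. -/
abbrev Cotangent (n : ℕ) {M : Type*} [TopologicalSpace M]
    [ChartedSpace (EuclideanSpace ℝ (Fin n)) M] (x : M) : Type :=
  TangentSpace (𝓡 n) x →L[ℝ] ℝ

instance finiteDimensional_tangentSpace (n : ℕ) {M : Type*} [TopologicalSpace M]
    [ChartedSpace (EuclideanSpace ℝ (Fin n)) M] (x : M) :
    FiniteDimensional ℝ (TangentSpace (𝓡 n) x) :=
  inferInstanceAs (FiniteDimensional ℝ (EuclideanSpace ℝ (Fin n)))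

instance t2Space_tangentSpace (n : ℕ) {M : Type*} [TopologicalSpace M]
    [ChartedSpace (EuclideanSpace ℝ (Fin n)) M] (x : M) : T2Space (TangentSpace (𝓡 n) x) :=
  inferInstanceAs (T2Space (EuclideanSpace ℝ (Fin n)))

section Basic

variable {n : ℕ} {M : Type*} [TopologicalSpace M] [ChartedSpace (EuclideanSpace ℝ (Fin n)) M]
  [IsManifold (𝓡 n) ∞ M]

/-- The vector field `X` is `C^∞` on the set `U`. -/
def SmoothField (U : Set M) (X : ∀ x : M, TangentSpace (𝓡 n) x) : Prop :=
  ContMDiffOn (𝓡 n) (𝓡 n).tangent ∞ (fun x => (X x : TangentBundle (𝓡 n) M)) U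

/-- The differential `1`-form `α` is `C^∞` on the set `U`, as a section of the cotangent bundle. -/
def SmoothForm (U : Set M) (α : ∀ x : M, Cotangent n x) : Prop :=
  ContMDiffOn (𝓡 n) ((𝓡 n).prod 𝓘(ℝ, EuclideanSpace ℝ (Fin n) →L[ℝ] ℝ)) ∞
    (fun x => Bundle.TotalSpace.mk' (EuclideanSpace ℝ (Fin n) →L[ℝ] ℝ)
      (E := fun x : M => TangentSpace (𝓡 n) x →L[ℝ] Bundle.Trivial M ℝ x) x (α x)) U

/-- The exterior derivative of a `1`-form, evaluated on vector fields:
`dα(X,Y) = X(α(Y)) - Y(α(X)) - α([X,Y])`. -/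
def extDerivForm (α : ∀ x : M, Cotangent n x) (X Y : ∀ x : M, TangentSpace (𝓡 n) x) (x : M) : ℝ :=
  mvfderiv (𝓡 n) (fun y => α y (Y y)) x (X x) - mvfderiv (𝓡 n) (fun y => α y (X y)) x (Y x)
    - α x (VectorField.mlieBracket (𝓡 n) X Y x)

/-- On the open set `U`, the `1`-form `η` is the Lie derivative `L_X β = d i(X) β + i(X) dβ`:
both sides agree on every vector field that is smooth on `U`. -/
def IsLieDerivForm (U : Set M) (X : ∀ x : M, TangentSpace (𝓡 n) x)
    (β η : ∀ x : M, Cotangent n x) : Prop :=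
  ∀ Y : ∀ x : M, TangentSpace (𝓡 n) x, SmoothField U Y → ∀ x ∈ U,
    η x (Y x) = mvfderiv (𝓡 n) (fun y => β y (X y)) x (Y x) + extDerivForm β X Y x

end Basic

/-- A `p`-dimensional `C^∞` foliation of an `n`-dimensional manifold `M`, given by its tangent
bundle `TF`: around each point there is an adapted chart `e = (x^a, y^u)`, with `n - p` transverse
coordinates `x^a` (the first ones) and `p` leaf coordinates `y^u`, on whose domain `TF` is the
common kernel of the `dx^a`; the leaves are given there by `x^a = const`. -/
structure Foliation (n p : ℕ) (M : Type*) [TopologicalSpace M]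
    [ChartedSpace (EuclideanSpace ℝ (Fin n)) M] [IsManifold (𝓡 n) ∞ M] where
  dim_le : p ≤ n
  /-- The tangent spaces `T_x F` of the leaves. -/
  tangent : ∀ x : M, Submodule ℝ (TangentSpace (𝓡 n) x)
  exists_adapted : ∀ x₀ : M, ∃ e ∈ IsManifold.maximalAtlas (𝓡 n) ∞ M, x₀ ∈ e.source ∧
    ∀ x ∈ e.source, ∀ v : TangentSpace (𝓡 n) x,
      v ∈ tangent x ↔
        ∀ a : Fin n, (a : ℕ) < n - p → mvfderiv (𝓡 n) (fun y => e y a) x v = 0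

namespace Foliation

variable {n p : ℕ} {M : Type*} [TopologicalSpace M] [ChartedSpace (EuclideanSpace ℝ (Fin n)) M]
  [IsManifold (𝓡 n) ∞ M]

/-- The fibre at `x` of the conormal bundle `ν*F`, that is, the annihilator of `T_x F`. -/
def conormal (F : Foliation n p M) (x : M) : Submodule ℝ (Cotangent n x) where
  carrier := {α | ∀ v ∈ F.tangent x, α v = 0}
  add_mem' := by
    intro α β hα hβ v hv
    simp [hα v hv, hβ v hv]
  zero_mem' := by
    intro v _
    simp
  smul_mem' := by
    intro c α hα v hv
    simp [hα v hv]

/-- `X` is a smooth vector field on the open set `U` that is foliated (projectable): its bracket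
with every vector field on `U` tangent to the leaves is tangent to the leaves. -/
def IsFoliatedField (F : Foliation n p M) (U : Set M)
    (X : ∀ x : M, TangentSpace (𝓡 n) x) : Prop :=
  SmoothField U X ∧
    ∀ V : ∀ x : M, TangentSpace (𝓡 n) x, SmoothField U V → (∀ x ∈ U, V x ∈ F.tangent x) →
      ∀ x ∈ U, VectorField.mlieBracket (𝓡 n) X V x ∈ F.tangent x

/-- `α` is a smooth `1`-form on the open set `U` that is foliated (projectable): `i(V) α = 0` and
`i(V) dα = 0` for every vector field `V` on `U` tangent to the leaves. -/
def IsFoliatedForm (F : Foliation n p M) (U : Set M) (α : ∀ x : M, F.conormal x) : Prop :=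
  SmoothForm U (fun x => (α x : Cotangent n x)) ∧
    ∀ V Y : ∀ x : M, TangentSpace (𝓡 n) x, SmoothField U V → SmoothField U Y →
      (∀ x ∈ U, V x ∈ F.tangent x) →
        ∀ x ∈ U, extDerivForm (fun y => (α y : Cotangent n y)) V Y x = 0

/-- A `C^∞` vector bundle morphism `h : ν*F → TM` over the identity of `M`. -/
structure Morphism (F : Foliation n p M) where
  toFun : ∀ x : M, F.conormal x →ₗ[ℝ] TangentSpace (𝓡 n) x
  smooth : ∀ U : Set M, IsOpen U → ∀ α : ∀ x : M, F.conormal x,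
    SmoothForm U (fun x => (α x : Cotangent n x)) → SmoothField U (fun x => toFun x (α x))

/-- `h : ν*F → TM` is a hamiltonian structure of the foliation: over every open set `U`, the map
`H` induced on the foliated `1`-forms takes values in the foliated vector fields, is skew-symmetric,
and satisfies `[H,H] = 0`, where
`[H,H](α,β,γ) = 2 (⟨H L_{Hα} β, γ⟩ + ⟨H L_{Hβ} γ, α⟩ + ⟨H L_{Hγ} α, β⟩)`.
Here `a`, `b`, `c` are the Lie derivatives `L_{Hα} β`, `L_{Hβ} γ`, `L_{Hγ} α`. -/
structure Morphism.IsHamiltonian {F : Foliation n p M} (h : F.Morphism) : Prop where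
  foliated : ∀ U : Set M, IsOpen U → ∀ α : ∀ x : M, F.conormal x,
    F.IsFoliatedForm U α → F.IsFoliatedField U (fun x => h.toFun x (α x))
  skew : ∀ U : Set M, IsOpen U → ∀ α β : ∀ x : M, F.conormal x,
    F.IsFoliatedForm U α → F.IsFoliatedForm U β → ∀ x ∈ U,
      (α x : Cotangent n x) (h.toFun x (β x)) = -(β x : Cotangent n x) (h.toFun x (α x))
  poisson : ∀ U : Set M, IsOpen U → ∀ α β γ : ∀ x : M, F.conormal x,
    F.IsFoliatedForm U α → F.IsFoliatedForm U β → F.IsFoliatedForm U γ →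
    ∀ a b c : ∀ x : M, F.conormal x,
      IsLieDerivForm U (fun x => h.toFun x (α x)) (fun x => (β x : Cotangent n x))
        (fun x => (a x : Cotangent n x)) →
      IsLieDerivForm U (fun x => h.toFun x (β x)) (fun x => (γ x : Cotangent n x))
        (fun x => (b x : Cotangent n x)) →
      IsLieDerivForm U (fun x => h.toFun x (γ x)) (fun x => (α x : Cotangent n x))
        (fun x => (c x : Cotangent n x)) →
      ∀ x ∈ U,
        2 * ((γ x : Cotangent n x) (h.toFun x (a x)) + (α x : Cotangent n x) (h.toFun x (b x))
          + (β x : Cotangent n x) (h.toFun x (c x))) = 0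

/-- A differentiable distribution `E` complementary to `TF`: `E ⊕ TF = TM`, and each vector of `E`
extends locally to a smooth section of `E`. -/
structure Complement (F : Foliation n p M) where
  dist : ∀ x : M, Submodule ℝ (TangentSpace (𝓡 n) x)
  isCompl : ∀ x : M, IsCompl (dist x) (F.tangent x)
  smooth : ∀ x₀ : M, ∀ v ∈ dist x₀, ∃ U : Set M, IsOpen U ∧ x₀ ∈ U ∧
    ∃ X : ∀ x : M, TangentSpace (𝓡 n) x,
      SmoothField U X ∧ X x₀ = v ∧ ∀ x ∈ U, X x ∈ dist x

/-- The projection `p_E : T_x M → T_x M` onto `E_x` along `T_x F`. -/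
def Complement.proj {F : Foliation n p M} (E : F.Complement) (x : M) :
    TangentSpace (𝓡 n) x →L[ℝ] TangentSpace (𝓡 n) x :=
  LinearMap.toContinuousLinearMap ((E.dist x).projection (F.tangent x) (E.isCompl x))

/-- The `(1,0)`-part `d'f = df ∘ p_E` of the differential of `f`, a section of `E* ≅ ν*F`. -/
def Complement.dPrime {F : Foliation n p M} (E : F.Complement) (f : M → ℝ) (x : M) :
    F.conormal x :=
  ⟨(mvfderiv (𝓡 n) f x).comp (E.proj x), by
    intro v hv
    have h0 : E.proj x v = 0 := by
      change (E.dist x).projection (F.tangent x) (E.isCompl x) v = 0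
      exact (Submodule.projection_apply_eq_zero_iff (E.isCompl x)).2 hv
    rw [ContinuousLinearMap.comp_apply, h0, map_zero]⟩

/-- `E` is an image extension of `h`: it contains `H₀ = im h`. -/
def Morphism.IsImageExtension {F : Foliation n p M} (h : F.Morphism) (E : F.Complement) : Prop :=
  ∀ x : M, LinearMap.range (h.toFun x) ≤ E.dist x

/-- `h` is a tame hamiltonian structure with image extension `E`: it is a hamiltonian structure,
`E` contains `H₀ = im h`, and `E` contains all the brackets of differentiable vector fields that
belong to `H₀`. -/
structure Morphism.IsTame {F : Foliation n p M} (h : F.Morphism) (E : F.Complement) : Prop where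
  isHamiltonian : h.IsHamiltonian
  isImageExtension : h.IsImageExtension E
  bracket_mem : ∀ X Y : ∀ x : M, TangentSpace (𝓡 n) x,
    SmoothField Set.univ X → SmoothField Set.univ Y →
    (∀ x, X x ∈ LinearMap.range (h.toFun x)) → (∀ x, Y x ∈ LinearMap.range (h.toFun x)) →
      ∀ x, VectorField.mlieBracket (𝓡 n) X Y x ∈ E.dist x

/-- The hamiltonian vector field `X'_f = H(d'f)` of an arbitrary function `f`. -/
def Morphism.hamField {F : Foliation n p M} (h : F.Morphism) (E : F.Complement) (f : M → ℝ)
    (x : M) : TangentSpace (𝓡 n) x :=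
  h.toFun x (E.dPrime f x)

/-- The extended bracket `{f,g}' = X'_f g = ⟨H d'f, dg⟩`. -/
def Morphism.extBracket {F : Foliation n p M} (h : F.Morphism) (E : F.Complement)
    (f g : M → ℝ) (x : M) : ℝ :=
  mvfderiv (𝓡 n) g x (h.hamField E f x)

end Foliation

section Poisson

/-- A Poisson structure on `M`, as a bracket on `C^∞(M)`: an `ℝ`-bilinear, skew-symmetric bracket
which satisfies the Leibniz rule and the Jacobi identity. -/
structure IsPoissonBracket {n : ℕ} {M : Type*} [TopologicalSpace M]
    [ChartedSpace (EuclideanSpace ℝ (Fin n)) M]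
    (B : C^∞⟮𝓡 n, M; ℝ⟯ →ₗ[ℝ] C^∞⟮𝓡 n, M; ℝ⟯ →ₗ[ℝ] C^∞⟮𝓡 n, M; ℝ⟯) : Prop where
  skew : ∀ f g, B f g = -B g f
  leibniz : ∀ f g k, B f (g * k) = B f g * k + g * B f k
  jacobi : ∀ f g k, B (B f g) k + B (B g k) f + B (B k f) g = 0

/-- A `C^∞` bivector field on `M`, as a skew-symmetric form on the cotangent spaces which takes
smooth `1`-forms to smooth functions. -/
structure BivectorField (n : ℕ) (M : Type*) [TopologicalSpace M]
    [ChartedSpace (EuclideanSpace ℝ (Fin n)) M] [IsManifold (𝓡 n) ∞ M] where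
  toFun : ∀ x : M, Cotangent n x →ₗ[ℝ] Cotangent n x →ₗ[ℝ] ℝ
  skew : ∀ (x : M) (α β : Cotangent n x), toFun x α β = -toFun x β α
  smooth : ∀ U : Set M, IsOpen U → ∀ α β : ∀ x : M, Cotangent n x,
    SmoothForm U α → SmoothForm U β →
      ContMDiffOn (𝓡 n) 𝓘(ℝ, ℝ) ∞ (fun x => toFun x (α x) (β x)) U

variable {n : ℕ} {M : Type*} [TopologicalSpace M] [ChartedSpace (EuclideanSpace ℝ (Fin n)) M]
  [IsManifold (𝓡 n) ∞ M]

/-- The map `♯_P : T*_x M → T_x M`, determined by `⟨♯_P α, β⟩ = P(α, β)`. -/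
def BivectorField.sharp (P : BivectorField n M) (x : M) (α : Cotangent n x) :
    TangentSpace (𝓡 n) x :=
  (Module.evalEquiv ℝ (TangentSpace (𝓡 n) x)).symm
    ((P.toFun x α).comp (LinearMap.toContinuousLinearMap :
      (TangentSpace (𝓡 n) x →ₗ[ℝ] ℝ) ≃ₗ[ℝ] (TangentSpace (𝓡 n) x →L[ℝ] ℝ)).toLinearMap)

theorem BivectorField.apply_sharp (P : BivectorField n M) (x : M) (α β : Cotangent n x) :
    β (P.sharp x α) = P.toFun x α β := by
  have h := Module.apply_evalEquiv_symm_apply ℝ (TangentSpace (𝓡 n) x) β.toLinearMap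
    ((P.toFun x α).comp (LinearMap.toContinuousLinearMap :
      (TangentSpace (𝓡 n) x →ₗ[ℝ] ℝ) ≃ₗ[ℝ] (TangentSpace (𝓡 n) x →L[ℝ] ℝ)).toLinearMap)
  exact h

/-- `P` is a Poisson bivector field: the bracket `P(df, dg)` is a Poisson bracket on `C^∞(M)`. -/
def BivectorField.IsPoisson (P : BivectorField n M) : Prop :=
  ∃ B : C^∞⟮𝓡 n, M; ℝ⟯ →ₗ[ℝ] C^∞⟮𝓡 n, M; ℝ⟯ →ₗ[ℝ] C^∞⟮𝓡 n, M; ℝ⟯,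
    (∀ f g x, B f g x = P.toFun x (mvfderiv (𝓡 n) f x) (mvfderiv (𝓡 n) g x)) ∧
      IsPoissonBracket B

end Poisson

end HamFol

end

/-! Skew-symmetry and the Leibniz rule are pointwise; the content is the Jacobi identity. The
hypothesis `[H,H] = 0` gives it only for basic functions, those constant along the leaves. Tameness
carries it over to arbitrary functions.

For basic `f` and `g`, `d'f = df` and `d'g = dg` are closed foliated forms, `{f,g}'` is again basic,
and `L_{Hd'f} d'g = d'{f,g}'`. Half of `[H,H](d'f,d'g,d'k)` is then the Jacobiator
(`IsTame.jacobi_of_isBasicOn`).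

For arbitrary `f`, `g`, `k` the Jacobiator is `dk(w)` with `w = X'_{{f,g}'} - [X'_f, X'_g]`. Both
terms lie in `E`, the second by tameness, so at a point `x` the Jacobiator depends on `k` only
through `d'k(x)` (`IsTame.exists_jacobiator_eq`). Its cyclic symmetry gives the same for `f` and
`g`. Every conormal covector at `x` is the differential of a global function that is basic near `x`
(`Complement.exists_basic_function`), so all three functions may be replaced by such ones.

The bivector is `P(α,β) = ⟨h(α ∘ p_E), β⟩`. Its smoothness rests on that of `p_E`, which is read off
from a local frame of `E` dual to transverse coordinates. -/

noncomputable section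

namespace HamFol

/-! ### The Lie bracket as a commutator of derivations. -/

section Bracket

variable {n : ℕ} {M : Type*} [TopologicalSpace M] [ChartedSpace (EuclideanSpace ℝ (Fin n)) M]
  [IsManifold (𝓡 n) ∞ M]

theorem mvfderiv_eq_fderiv_extChartAt {x y : M} (hy : y ∈ (extChartAt (𝓡 n) x).source) {f : M → ℝ}
    (hf : MDifferentiableAt (𝓡 n) 𝓘(ℝ, ℝ) f y) (v : TangentSpace (𝓡 n) y) :
    mvfderiv (𝓡 n) f y v =
      fderiv ℝ (f ∘ (extChartAt (𝓡 n) x).symm) (extChartAt (𝓡 n) x y)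
        (mfderiv (𝓡 n) 𝓘(ℝ, EuclideanSpace ℝ (Fin n)) (extChartAt (𝓡 n) x) y v) := by
  have hφ : MDifferentiableAt (𝓡 n) 𝓘(ℝ, EuclideanSpace ℝ (Fin n)) (extChartAt (𝓡 n) x) y :=
    mdifferentiableAt_extChartAt (by simpa using hy)
  have hg : MDifferentiableAt 𝓘(ℝ, EuclideanSpace ℝ (Fin n)) 𝓘(ℝ, ℝ)
      (f ∘ (extChartAt (𝓡 n) x).symm) (extChartAt (𝓡 n) x y) := by
    have h1 := mdifferentiableWithinAt_extChartAt_symm (I := 𝓡 n) ((extChartAt (𝓡 n) x).map_source hy)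
    rw [modelWithCornersSelf_coe, Set.range_id, mdifferentiableWithinAt_univ] at h1
    refine MDifferentiableAt.comp _ ?_ h1
    rwa [(extChartAt (𝓡 n) x).left_inv hy]
  have h2 : f =ᶠ[𝓝 y] (f ∘ (extChartAt (𝓡 n) x).symm) ∘ (extChartAt (𝓡 n) x) := by
    filter_upwards [extChartAt_source_mem_nhds' (I := 𝓡 n) hy] with z hz
    exact (congrArg f ((extChartAt (𝓡 n) x).left_inv hz)).symm
  have h3 : mvfderiv (𝓡 n) f y =
      mvfderiv (𝓡 n) ((f ∘ (extChartAt (𝓡 n) x).symm) ∘ (extChartAt (𝓡 n) x)) y := by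
    have := h2.mfderiv_eq (I := 𝓡 n) (I' := 𝓘(ℝ, ℝ))
    ext v
    exact congrArg (fun L => L v) this
  rw [h3, mvfderiv_comp_apply y hg hφ]
  rw [← mfderiv_eq_fderiv]
  rfl

theorem mpullbackWithin_extChartAt_symm_apply {x y : M} (hy : y ∈ (extChartAt (𝓡 n) x).source)
    (V : ∀ x : M, TangentSpace (𝓡 n) x) :
    VectorField.mpullbackWithin 𝓘(ℝ, EuclideanSpace ℝ (Fin n)) (𝓡 n) (extChartAt (𝓡 n) x).symm V
      (Set.range (𝓡 n)) (extChartAt (𝓡 n) x y) =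
    mfderiv (𝓡 n) 𝓘(ℝ, EuclideanSpace ℝ (Fin n)) (extChartAt (𝓡 n) x) y (V y) := by
  have A : (extChartAt (𝓡 n) x).symm (extChartAt (𝓡 n) x y) = y := (extChartAt (𝓡 n) x).left_inv hy
  rw [VectorField.mpullbackWithin_apply, A]
  have h1 := mfderivWithin_extChartAt_symm_comp_mfderiv_extChartAt' (I := 𝓡 n) hy
  have h2 := mfderiv_extChartAt_comp_mfderivWithin_extChartAt_symm' (I := 𝓡 n) hy
  have h3 := ContinuousLinearMap.inverse_eq h1 h2
  erw [h3]

theorem mdifferentiableAt_of_smoothField {U : Set M} (hU : IsOpen U)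
    {X : ∀ x : M, TangentSpace (𝓡 n) x} (hX : SmoothField U X) {x : M} (hx : x ∈ U) :
    MDifferentiableAt (𝓡 n) (𝓡 n).tangent (fun y => (X y : TangentBundle (𝓡 n) M)) x :=
  (hX.contMDiffAt (hU.mem_nhds hx)).mdifferentiableAt (by simp)

/-- The Lie bracket acts on functions as the commutator of derivations. -/
theorem mvfderiv_mlieBracket {x : M} {f : M → ℝ} (hf : ContMDiffAt (𝓡 n) 𝓘(ℝ, ℝ) ∞ f x)
    {V W : ∀ x : M, TangentSpace (𝓡 n) x}
    (hV : MDifferentiableAt (𝓡 n) (𝓡 n).tangent (fun y => (V y : TangentBundle (𝓡 n) M)) x)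
    (hW : MDifferentiableAt (𝓡 n) (𝓡 n).tangent (fun y => (W y : TangentBundle (𝓡 n) M)) x) :
    mvfderiv (𝓡 n) f x (VectorField.mlieBracket (𝓡 n) V W x) =
      mvfderiv (𝓡 n) (fun y => mvfderiv (𝓡 n) f y (W y)) x (V x) -
        mvfderiv (𝓡 n) (fun y => mvfderiv (𝓡 n) f y (V y)) x (W x) := by
  have hxs := mem_extChartAt_source (I := 𝓡 n) x
  have hf1 : ∀ᶠ y in 𝓝 x, MDifferentiableAt (𝓡 n) 𝓘(ℝ, ℝ) f y := by
    have h1 : ContMDiffAt (𝓡 n) 𝓘(ℝ, ℝ) 1 f x := hf.of_le (by exact_mod_cast le_top)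
    filter_upwards [(contMDiffAt_iff_contMDiffAt_nhds (by simp)).1 h1] with y hy
    exact hy.mdifferentiableAt (by simp)
  set φ := extChartAt (𝓡 n) x with hφ
  have huniv : φ.symm ⁻¹' Set.univ ∩ Set.range (𝓡 n) = Set.univ := by simp
  have hsymm : ContMDiffAt 𝓘(ℝ, EuclideanSpace ℝ (Fin n)) (𝓡 n) ∞ φ.symm (φ x) := by
    have := contMDiffWithinAt_extChartAt_symm_range_self (I := 𝓡 n) (n := ∞) x
    rwa [modelWithCornersSelf_coe, Set.range_id, contMDiffWithinAt_univ] at this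
  have hg : ContDiffAt ℝ ∞ (f ∘ φ.symm) (φ x) := by
    rw [← contMDiffAt_iff_contDiffAt]
    refine ContMDiffAt.comp _ ?_ hsymm
    rwa [hφ, extChartAt_to_inv]
  have key : ∀ W : ∀ x : M, TangentSpace (𝓡 n) x,
      MDifferentiableAt (𝓡 n) (𝓡 n).tangent (fun y => (W y : TangentBundle (𝓡 n) M)) x →
      DifferentiableAt ℝ (VectorField.mpullbackWithin 𝓘(ℝ, EuclideanSpace ℝ (Fin n)) (𝓡 n)
        φ.symm W (Set.range (𝓡 n))) (φ x) := by
    intro W hW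
    have := MDifferentiableWithinAt.differentiableWithinAt_mpullbackWithin_vectorField
      (s := Set.univ) hW.mdifferentiableWithinAt
    rw [huniv] at this
    exact differentiableWithinAt_univ.1 this
  -- In the chart, `V(Wf)` is the iterated flat derivative of `f ∘ φ⁻¹` along the pulled back
  -- fields.
  have key2 : ∀ V W : ∀ x : M, TangentSpace (𝓡 n) x,
      MDifferentiableAt (𝓡 n) (𝓡 n).tangent (fun y => (W y : TangentBundle (𝓡 n) M)) x →
      mvfderiv (𝓡 n) (fun y => mvfderiv (𝓡 n) f y (W y)) x (V x) =
      fderiv ℝ (fun z => fderiv ℝ (f ∘ φ.symm) z (VectorField.mpullbackWithin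
        𝓘(ℝ, EuclideanSpace ℝ (Fin n)) (𝓡 n) φ.symm W (Set.range (𝓡 n)) z)) (φ x)
        (VectorField.mpullbackWithin
        𝓘(ℝ, EuclideanSpace ℝ (Fin n)) (𝓡 n) φ.symm V (Set.range (𝓡 n)) (φ x)) := by
    intro V W hW
    set G : EuclideanSpace ℝ (Fin n) → ℝ := fun z => fderiv ℝ (f ∘ φ.symm) z
      (VectorField.mpullbackWithin 𝓘(ℝ, EuclideanSpace ℝ (Fin n)) (𝓡 n) φ.symm W
        (Set.range (𝓡 n)) z) with hG
    have hGd : DifferentiableAt ℝ G (φ x) := by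
      refine DifferentiableAt.clm_apply ?_ (key W hW)
      exact (hg.fderiv_right (m := 1) (by rw [one_add_one_eq_two]; exact ENat.LEInfty.out)).differentiableAt (by simp)
    have hev : (fun y => mvfderiv (𝓡 n) f y (W y)) =ᶠ[𝓝 x] G ∘ φ := by
      filter_upwards [hf1, extChartAt_source_mem_nhds (I := 𝓡 n) x] with y hy hys
      rw [mvfderiv_eq_fderiv_extChartAt hys hy, ← mpullbackWithin_extChartAt_symm_apply hys]
      rfl
    have h3 : mvfderiv (𝓡 n) (fun y => mvfderiv (𝓡 n) f y (W y)) x =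
        mvfderiv (𝓡 n) (G ∘ φ) x := by
      have := hev.mfderiv_eq (I := 𝓡 n) (I' := 𝓘(ℝ, ℝ))
      ext v
      exact congrArg (fun L => L v) this
    rw [h3, mvfderiv_comp_apply x hGd.mdifferentiableAt
      (mdifferentiableAt_extChartAt (mem_chart_source _ x)),
      mpullbackWithin_extChartAt_symm_apply hxs]
    simp only [mvfderiv, mfderiv_eq_fderiv]
    rfl
  -- The flat identity holds because the second derivative is symmetric, so its terms cancel in the
  -- commutator.
  rw [key2 V W hW, key2 W V hV, ← VectorField.fderiv_apply_lieBracket hg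
    (by simpa using ENat.LEInfty.out) (key W hW) (key V hV),
    mvfderiv_eq_fderiv_extChartAt hxs hf1.self_of_nhds]
  congr 1
  -- The manifold bracket is by definition the chart bracket pulled back by the inverse of `dφ`,
  -- which cancels against `dφ`.
  rw [← VectorField.mlieBracketWithin_univ, VectorField.mlieBracketWithin_apply, huniv]
  refine ((isInvertible_mfderiv_extChartAt hxs).self_apply_inverse _).trans ?_
  exact congrFun (VectorField.lieBracketWithin_univ (E := EuclideanSpace ℝ (Fin n))) _

end Bracket

/-! ### Locality and linearity of the differential. -/

theorem mvfderiv_congr {n : ℕ} {M : Type*} [TopologicalSpace M]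
    [ChartedSpace (EuclideanSpace ℝ (Fin n)) M] {x : M} {f g : M → ℝ} (h : f =ᶠ[𝓝 x] g) :
    mvfderiv (𝓡 n) f x = mvfderiv (𝓡 n) g x := by
  have := h.mfderiv_eq (I := 𝓡 n) (I' := 𝓘(ℝ, ℝ))
  ext v
  exact congrArg (fun L => L v) this

theorem mvfderiv_const_smul {n : ℕ} {M : Type*} [TopologicalSpace M]
    [ChartedSpace (EuclideanSpace ℝ (Fin n)) M] (c : ℝ) {f : M → ℝ} {x : M}
    (hf : MDifferentiableAt (𝓡 n) 𝓘(ℝ, ℝ) f x) :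
    mvfderiv (𝓡 n) (c • f) x = c • mvfderiv (𝓡 n) f x := by
  ext v
  exact congrArg (fun L => L v) (hf.hasMFDerivAt.const_smul c).mfderiv

theorem mvfderiv_sum_const_mul {n : ℕ} {M : Type*} [TopologicalSpace M]
    [ChartedSpace (EuclideanSpace ℝ (Fin n)) M] {ι : Type} (s : Finset ι) (c : ι → ℝ)
    {ξ : ι → M → ℝ} {x : M} (hξ : ∀ i ∈ s, MDifferentiableAt (𝓡 n) 𝓘(ℝ, ℝ) (ξ i) x) :
    mvfderiv (𝓡 n) (fun y => ∑ i ∈ s, c i * ξ i y) x = ∑ i ∈ s, c i • mvfderiv (𝓡 n) (ξ i) x := by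
  have h1 : ∀ i ∈ s, HasMFDerivAt (𝓡 n) 𝓘(ℝ, ℝ) (fun y => c i * ξ i y) x
      (c i • mvfderiv (𝓡 n) (ξ i) x) := fun i hi => (hξ i hi).hasMFDerivAt.const_smul (c i)
  have h2 := HasMFDerivAt.sum (E' := ℝ) (f := fun i y => c i * ξ i y) h1
  rw [Finset.sum_fn] at h2
  ext v
  exact congrArg (fun L => L v) h2.mfderiv

/-! ### Smooth forms and fields. -/

section Smooth

variable {n : ℕ} {M : Type*} [TopologicalSpace M] [ChartedSpace (EuclideanSpace ℝ (Fin n)) M]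
  [IsManifold (𝓡 n) ∞ M]

theorem SmoothForm.apply {U : Set M} {α : ∀ x : M, Cotangent n x}
    {X : ∀ x : M, TangentSpace (𝓡 n) x} (hα : SmoothForm U α) (hX : SmoothField U X) :
    ContMDiffOn (𝓡 n) 𝓘(ℝ, ℝ) ∞ (fun x => α x (X x)) U := by
  have := ContMDiffOn.clm_bundle_apply (E₂ := Bundle.Trivial M ℝ) hα hX
  intro x hx
  have h1 := this x hx
  rw [Bundle.contMDiffWithinAt_totalSpace] at h1
  exact h1.2

theorem smoothForm_mvfderiv {U : Set M} (hU : IsOpen U) {f : M → ℝ}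
    (hf : ContMDiffOn (𝓡 n) 𝓘(ℝ, ℝ) ∞ f U) : SmoothForm U (mvfderiv (𝓡 n) f) := by
  intro x hx
  apply ContMDiffAt.contMDiffWithinAt
  have h1 := (hf.contMDiffAt (hU.mem_nhds hx)).mfderiv_const (m := ∞) le_rfl
  rw [contMDiffAt_hom_bundle]
  refine ⟨contMDiffAt_id, ?_⟩
  -- In the trivializations of the hom bundle the section `df` is the derivative in tangent
  -- coordinates, whose smoothness is `h1`.
  convert! h1 using 1
  ext y v
  simp [inTangentCoordinates, ContinuousLinearMap.inCoordinates, mvfderiv]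
  rfl

theorem SmoothForm.mono {U V : Set M} {α : ∀ x : M, Cotangent n x} (hα : SmoothForm U α)
    (h : V ⊆ U) : SmoothForm V α := ContMDiffOn.mono hα h

theorem SmoothForm.sum_smul {ι : Type*} [Fintype ι] {U : Set M} {c : ι → M → ℝ}
    {α : ι → ∀ x : M, Cotangent n x} (hc : ∀ i, ContMDiffOn (𝓡 n) 𝓘(ℝ, ℝ) ∞ (c i) U)
    (hα : ∀ i, SmoothForm U (α i)) : SmoothForm U (fun x => ∑ i, c i x • α i x) := by
  have := ContMDiffOn.sum_section (s := Finset.univ) (t := fun i x => c i x • α i x)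
    (F := EuclideanSpace ℝ (Fin n) →L[ℝ] ℝ)
    (V := fun x : M => TangentSpace (𝓡 n) x →L[ℝ] Bundle.Trivial M ℝ x) (I := 𝓡 n) (n := ∞) (u := U)
    (fun i _ => (hc i).smul_section (hα i))
  exact this

theorem SmoothField.sum_smul {ι : Type*} [Fintype ι] {U : Set M} {c : ι → M → ℝ}
    {X : ι → ∀ x : M, TangentSpace (𝓡 n) x} (hc : ∀ i, ContMDiffOn (𝓡 n) 𝓘(ℝ, ℝ) ∞ (c i) U)
    (hX : ∀ i, SmoothField U (X i)) : SmoothField U (fun x => ∑ i, c i x • X i x) :=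
  ContMDiffOn.sum_section (s := Finset.univ) (t := fun i x => c i x • X i x)
    (fun i _ => (hc i).smul_section (hX i))

theorem exists_smoothField_eq {x : M} (v : TangentSpace (𝓡 n) x) :
    ∃ U : Set M, IsOpen U ∧ x ∈ U ∧ ∃ X : ∀ x : M, TangentSpace (𝓡 n) x,
      SmoothField U X ∧ X x = v := by
  obtain ⟨s, hs, h⟩ := FiberBundle.exists_contMDiffOn_extend (k := ∞) (𝓡 n)
    (EuclideanSpace ℝ (Fin n)) v
  obtain ⟨U, hUs, hU, hx⟩ := mem_nhds_iff.1 hs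
  exact ⟨U, hU, hx, _, h.mono hUs, by simp⟩

end Smooth

/-! ### Smoothness of the inverse matrix, by Cramer's rule. -/

section Matrix

variable {n : ℕ} {M : Type*} [TopologicalSpace M] [ChartedSpace (EuclideanSpace ℝ (Fin n)) M]
  {ι : Type*} [Fintype ι] [DecidableEq ι]

theorem contMDiffOn_det {U : Set M} {A : M → Matrix ι ι ℝ}
    (hA : ∀ i j, ContMDiffOn (𝓡 n) 𝓘(ℝ, ℝ) ∞ (fun x => A x i j) U) :
    ContMDiffOn (𝓡 n) 𝓘(ℝ, ℝ) ∞ (fun x => (A x).det) U := by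
  simp only [Matrix.det_apply, Units.smul_def, zsmul_eq_mul]
  exact contMDiffOn_finsetSum fun σ _ =>
    contMDiffOn_const.mul (contMDiffOn_finsetProd fun i _ => hA _ _)

theorem contMDiffOn_matrix_inv {U : Set M} {A : M → Matrix ι ι ℝ}
    (hA : ∀ i j, ContMDiffOn (𝓡 n) 𝓘(ℝ, ℝ) ∞ (fun x => A x i j) U)
    (hdet : ∀ x ∈ U, (A x).det ≠ 0) (i j : ι) :
    ContMDiffOn (𝓡 n) 𝓘(ℝ, ℝ) ∞ (fun x => (A x)⁻¹ i j) U := by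
  simp only [Matrix.inv_def, Ring.inverse_eq_inv', Matrix.smul_apply, smul_eq_mul,
    Matrix.adjugate_apply]
  refine ((contMDiffOn_det hA).inv₀ hdet).mul (contMDiffOn_det fun k l => ?_)
  by_cases h : k = j
  · simp only [Matrix.updateRow_apply, if_pos h]
    exact contMDiffOn_const
  · simp only [Matrix.updateRow_apply, if_neg h]
    exact hA k l

end Matrix

/-! ### Local frames of the complement. -/

section Frame

variable {n p : ℕ} {M : Type*} [TopologicalSpace M] [ChartedSpace (EuclideanSpace ℝ (Fin n)) M]

theorem exists_mvfderiv_chart_eq {e : OpenPartialHomeomorph M (EuclideanSpace ℝ (Fin n))}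
    (he : e ∈ IsManifold.maximalAtlas (𝓡 n) ∞ M) {x : M} (hx : x ∈ e.source)
    (w : EuclideanSpace ℝ (Fin n)) :
    ∃ v : TangentSpace (𝓡 n) x, ∀ a : Fin n, mvfderiv (𝓡 n) (fun y => e y a) x v = w a := by
  have hd : e.MDifferentiable (𝓡 n) (𝓡 n) :=
    ⟨(contMDiffOn_of_mem_maximalAtlas he).mdifferentiableOn (by simp),
      (contMDiffOn_symm_of_mem_maximalAtlas he).mdifferentiableOn (by simp)⟩
  obtain ⟨v, hv⟩ := hd.mfderiv_surjective hx w
  refine ⟨v, fun a => ?_⟩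
  have hp : MDifferentiableAt (𝓡 n) 𝓘(ℝ, ℝ)
      (EuclideanSpace.proj a : EuclideanSpace ℝ (Fin n) →L[ℝ] ℝ) (e x) :=
    ContinuousLinearMap.mdifferentiableAt _
  have h1 := mvfderiv_comp_apply x hp (hd.mdifferentiableAt hx) v
  rw [hv] at h1
  refine h1.trans ?_
  have h2 := ContinuousLinearMap.mfderiv_eq (x := e x)
    (EuclideanSpace.proj a : EuclideanSpace ℝ (Fin n) →L[ℝ] ℝ)
  exact congrArg (fun L => L w) h2

variable [IsManifold (𝓡 n) ∞ M]

/-- Near each point, a complement `E` of a foliation has a smooth frame dual to the differentials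
of transverse coordinates. -/
theorem Foliation.Complement.exists_frame {F : Foliation n p M} (E : F.Complement) (x₀ : M) :
    ∃ U : Set M, IsOpen U ∧ x₀ ∈ U ∧
      ∃ (ξ : {a : Fin n // (a : ℕ) < n - p} → M → ℝ)
        (Z : {a : Fin n // (a : ℕ) < n - p} → ∀ x : M, TangentSpace (𝓡 n) x),
        (∀ i, ContMDiffOn (𝓡 n) 𝓘(ℝ, ℝ) ∞ (ξ i) U) ∧ (∀ i, SmoothField U (Z i)) ∧
        (∀ x ∈ U, ∀ v, v ∈ F.tangent x ↔ ∀ i, mvfderiv (𝓡 n) (ξ i) x v = 0) ∧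
        (∀ x ∈ U, ∀ i, Z i x ∈ E.dist x) ∧
        (∀ x ∈ U, ∀ i j, mvfderiv (𝓡 n) (ξ i) x (Z j x) = (1 : Matrix _ _ ℝ) i j) := by
  obtain ⟨e, he, hx₀, hF⟩ := F.exists_adapted x₀
  set ι := {a : Fin n // (a : ℕ) < n - p} with hι
  set ξ : ι → M → ℝ := fun i y => e y i with hξ
  have hξs : ∀ i, ContMDiffOn (𝓡 n) 𝓘(ℝ, ℝ) ∞ (ξ i) e.source := fun i =>
    (EuclideanSpace.proj (i : Fin n) : EuclideanSpace ℝ (Fin n) →L[ℝ] ℝ).contMDiff.comp_contMDiffOn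
      (contMDiffOn_of_mem_maximalAtlas he)
  have hFξ : ∀ x ∈ e.source, ∀ v, v ∈ F.tangent x ↔ ∀ i, mvfderiv (𝓡 n) (ξ i) x v = 0 := by
    intro x hx v
    rw [hF x hx v]
    exact ⟨fun h i => h i i.2, fun h a ha => h ⟨a, ha⟩⟩
  have hv : ∀ j : ι, ∃ v ∈ E.dist x₀, ∀ i, mvfderiv (𝓡 n) (ξ i) x₀ v = (1 : Matrix ι ι ℝ) i j := by
    intro j
    obtain ⟨v, hv⟩ := exists_mvfderiv_chart_eq he hx₀ (EuclideanSpace.single (j : Fin n) (1 : ℝ))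
    -- Dropping the component tangent to the leaves does not change the values of the `dξ i`.
    obtain ⟨a, b, ha, hb, hab⟩ := Submodule.codisjoint_iff_exists_add_eq.1 (E.isCompl x₀).codisjoint v
    refine ⟨a, ha, fun i => ?_⟩
    have h1 := (hFξ x₀ hx₀ b).1 hb i
    have h2 := hv i
    rw [← hab, map_add] at h2
    simp only [hξ] at h1 ⊢
    rw [h1, add_zero] at h2
    rw [h2, Matrix.one_apply]
    by_cases h : i = j
    · simp [h]
    · simp [h, mt Subtype.ext h]
  choose v hvE hvξ using hv
  have hX := fun j => E.smooth x₀ (v j) (hvE j)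
  choose W hWo hxW X hX hXv hXE using hX
  set U₁ : Set M := e.source ∩ ⋂ j, W j with hU₁
  have hU₁o : IsOpen U₁ := e.open_source.inter (isOpen_iInter_of_finite hWo)
  have hU₁e : U₁ ⊆ e.source := Set.inter_subset_left
  have hU₁W : ∀ j, U₁ ⊆ W j := fun j => Set.inter_subset_right.trans (Set.iInter_subset _ j)
  have hxU₁ : x₀ ∈ U₁ := ⟨hx₀, Set.mem_iInter.2 hxW⟩
  -- The extended vectors are dual to the `dξ i` only at `x₀`. There `A = 1`, so `A` stays
  -- invertible nearby, and correcting by `A⁻¹` makes the frame dual throughout a neighbourhood.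
  set A : M → Matrix ι ι ℝ := fun x => Matrix.of fun i j => mvfderiv (𝓡 n) (ξ i) x (X j x) with hA
  have hAs : ∀ i j, ContMDiffOn (𝓡 n) 𝓘(ℝ, ℝ) ∞ (fun x => A x i j) U₁ := fun i j =>
    (smoothForm_mvfderiv hU₁o ((hξs i).mono hU₁e)).apply ((hX j).mono (hU₁W j))
  have hA₀ : A x₀ = 1 := by
    ext i j
    simp only [hA, Matrix.of_apply, hXv, hvξ]
  refine ⟨U₁ ∩ (fun x => (A x).det) ⁻¹' {0}ᶜ,
    (contMDiffOn_det hAs).continuousOn.isOpen_inter_preimage hU₁o isOpen_compl_singleton,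
    ⟨hxU₁, by simp [hA₀]⟩, ξ, fun j x => ∑ k, (A x)⁻¹ k j • X k x,
    fun i => (hξs i).mono (Set.inter_subset_left.trans hU₁e), fun j => ?_,
    fun x hx => hFξ x (hU₁e hx.1), fun x hx j => ?_, fun x hx i j => ?_⟩
  · exact SmoothField.sum_smul (fun k => contMDiffOn_matrix_inv
      (fun i j => (hAs i j).mono Set.inter_subset_left) (fun x hx => hx.2) k j)
      fun k => (hX k).mono (Set.inter_subset_left.trans (hU₁W k))
  · exact Submodule.sum_mem _ fun k _ => Submodule.smul_mem _ _ (hXE k x (hU₁W k hx.1))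
  · rw [map_sum]
    have h1 : A x * (A x)⁻¹ = 1 := Matrix.mul_nonsing_inv _ (isUnit_iff_ne_zero.2 hx.2)
    rw [← h1, Matrix.mul_apply]
    refine Finset.sum_congr rfl fun k _ => ?_
    rw [map_smul, smul_eq_mul, mul_comm]
    rfl

end Frame

/-! ### The projection `p_E` and the extension of vectors and covectors. -/

namespace Foliation

variable {n p : ℕ} {M : Type*} [TopologicalSpace M] [ChartedSpace (EuclideanSpace ℝ (Fin n)) M]
  [IsManifold (𝓡 n) ∞ M] {F : Foliation n p M}

namespace Complement

variable (E : F.Complement)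

theorem proj_mem (x : M) (v : TangentSpace (𝓡 n) x) : E.proj x v ∈ E.dist x :=
  Submodule.projection_apply_mem (E.isCompl x) v

theorem proj_of_mem {x : M} {v : TangentSpace (𝓡 n) x} (hv : v ∈ E.dist x) : E.proj x v = v :=
  (Submodule.projection_eq_self_iff (E.isCompl x) v).2 hv

theorem proj_eq_zero_iff {x : M} {v : TangentSpace (𝓡 n) x} :
    E.proj x v = 0 ↔ v ∈ F.tangent x :=
  Submodule.projection_apply_eq_zero_iff (E.isCompl x)

theorem sub_proj_mem (x : M) (v : TangentSpace (𝓡 n) x) : v - E.proj x v ∈ F.tangent x := by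
  rw [← E.proj_eq_zero_iff, map_sub, E.proj_of_mem (E.proj_mem x v), sub_self]

theorem conormal_proj {x : M} (α : F.conormal x) (v : TangentSpace (𝓡 n) x) :
    (α : Cotangent n x) (E.proj x v) = (α : Cotangent n x) v := by
  have := α.2 _ (E.sub_proj_mem x v)
  rw [map_sub, sub_eq_zero] at this
  exact this.symm

/-- The `(1,0)`-part `α ∘ p_E` of a covector. -/
def pull (x : M) : Cotangent n x →ₗ[ℝ] F.conormal x where
  toFun α := ⟨α.comp (E.proj x), fun v hv => by
    rw [ContinuousLinearMap.comp_apply, E.proj_eq_zero_iff.2 hv, map_zero]⟩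
  map_add' _ _ := rfl
  map_smul' _ _ := rfl

theorem pull_apply {x : M} (α : Cotangent n x) (v : TangentSpace (𝓡 n) x) :
    (E.pull x α : Cotangent n x) v = α (E.proj x v) := rfl

theorem pull_conormal {x : M} (α : F.conormal x) : E.pull x (α : Cotangent n x) = α :=
  Subtype.ext (ContinuousLinearMap.ext fun v => E.conormal_proj α v)

theorem pull_of_mem {x : M} (α : Cotangent n x) {v : TangentSpace (𝓡 n) x} (hv : v ∈ E.dist x) :
    (E.pull x α : Cotangent n x) v = α v := by
  rw [pull_apply, E.proj_of_mem hv]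

theorem dPrime_eq_pull (f : M → ℝ) (x : M) : E.dPrime f x = E.pull x (mvfderiv (𝓡 n) f x) := rfl

/-- The sum lies in `E` and differs from `v` by a vector killed by every `ξ i`, hence tangent to the
leaves. In a smooth dual frame this formula shows that `p_E` is smooth. -/
theorem proj_eq_sum {x : M} {ι : Type*} [Fintype ι] [DecidableEq ι] {ξ : ι → Cotangent n x}
    {Z : ι → TangentSpace (𝓡 n) x} (hF : ∀ v, v ∈ F.tangent x ↔ ∀ i, ξ i v = 0)
    (hZ : ∀ i, Z i ∈ E.dist x) (hξZ : ∀ i j, ξ i (Z j) = (1 : Matrix ι ι ℝ) i j)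
    (v : TangentSpace (𝓡 n) x) : E.proj x v = ∑ i, ξ i v • Z i := by
  have h1 : v - ∑ i, ξ i v • Z i ∈ F.tangent x := by
    rw [hF]
    intro j
    simp [map_sum, hξZ, Matrix.one_apply]
  have h2 : ∑ i, ξ i v • Z i ∈ E.dist x :=
    Submodule.sum_mem _ fun i _ => Submodule.smul_mem _ _ (hZ i)
  rw [← E.proj_eq_zero_iff, map_sub, E.proj_of_mem h2, sub_eq_zero] at h1
  exact h1

theorem smoothField_proj {U : Set M} (hU : IsOpen U) {X : ∀ x : M, TangentSpace (𝓡 n) x}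
    (hX : SmoothField U X) : SmoothField U (fun x => E.proj x (X x)) := by
  intro x hx
  obtain ⟨W, hW, hxW, ξ, Z, hξ, hZ, hF, hZE, hξZ⟩ := E.exists_frame x
  have hWU : IsOpen (W ∩ U) := hW.inter hU
  have h1 : SmoothField (W ∩ U) (fun y => ∑ i, mvfderiv (𝓡 n) (ξ i) y (X y) • Z i y) :=
    SmoothField.sum_smul (fun i => (smoothForm_mvfderiv hWU
      ((hξ i).mono Set.inter_subset_left)).apply (hX.mono Set.inter_subset_right))
      fun i => (hZ i).mono Set.inter_subset_left
  have h2 : SmoothField (W ∩ U) (fun y => E.proj y (X y)) := h1.congr fun y hy => by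
    dsimp only
    rw [E.proj_eq_sum (hF y hy.1) (hZE y hy.1) (hξZ y hy.1)]
  exact (h2.contMDiffAt (hWU.mem_nhds ⟨hxW, hx⟩)).contMDiffWithinAt

theorem smoothForm_pull {U : Set M} (hU : IsOpen U) {α : ∀ x : M, Cotangent n x}
    (hα : SmoothForm U α) : SmoothForm U (fun x => (E.pull x (α x) : Cotangent n x)) := by
  intro x hx
  obtain ⟨W, hW, hxW, ξ, Z, hξ, hZ, hF, hZE, hξZ⟩ := E.exists_frame x
  have hWU : IsOpen (W ∩ U) := hW.inter hU
  have h1 : SmoothForm (W ∩ U) (fun y => ∑ i, α y (Z i y) • mvfderiv (𝓡 n) (ξ i) y) :=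
    SmoothForm.sum_smul (fun i => (hα.mono Set.inter_subset_right).apply
      ((hZ i).mono Set.inter_subset_left)) fun i => smoothForm_mvfderiv hWU
      ((hξ i).mono Set.inter_subset_left)
  have h2 : SmoothForm (W ∩ U) (fun y => (E.pull y (α y) : Cotangent n y)) :=
    ContMDiffOn.congr h1 fun y hy => by
      congr 1
      ext v
      rw [E.pull_apply, E.proj_eq_sum (hF y hy.1) (hZE y hy.1) (hξZ y hy.1), map_sum,
        sum_apply]
      refine Finset.sum_congr rfl fun i _ => ?_
      rw [map_smul, smul_apply, smul_eq_mul, smul_eq_mul, mul_comm]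
  exact (h2.contMDiffAt (hWU.mem_nhds ⟨hxW, hx⟩)).contMDiffWithinAt

/-- Each vector tangent to the leaves extends locally to a smooth field tangent to the leaves. -/
theorem exists_tangent_field (E : F.Complement) {x : M} {v : TangentSpace (𝓡 n) x} (hv : v ∈ F.tangent x) :
    ∃ U : Set M, IsOpen U ∧ x ∈ U ∧ ∃ V : ∀ x : M, TangentSpace (𝓡 n) x,
      SmoothField U V ∧ V x = v ∧ ∀ y, V y ∈ F.tangent y := by
  obtain ⟨U, hU, hxU, X, hX, hXv⟩ := exists_smoothField_eq v
  refine ⟨U, hU, hxU, fun y => X y - E.proj y (X y), ?_, ?_, fun y => E.sub_proj_mem y _⟩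
  · exact hX.sub_section (E.smoothField_proj hU hX)
  · simp only [hXv, E.proj_eq_zero_iff.2 hv, sub_zero]

/-- Each conormal covector is the differential of a global function that is constant along the
leaves near the base point. -/
theorem exists_basic_function [T2Space M] (E : F.Complement) (x : M) (α : F.conormal x) :
    ∃ f : C^∞⟮𝓡 n, M; ℝ⟯, mvfderiv (𝓡 n) f x = α ∧
      ∃ U : Set M, IsOpen U ∧ x ∈ U ∧ ∀ y ∈ U, ∀ v ∈ F.tangent y, mvfderiv (𝓡 n) f y v = 0 := by
  obtain ⟨W, hW, hxW, ξ, Z, hξ, hZ, hF, hZE, hξZ⟩ := E.exists_frame x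
  -- A combination of the transverse coordinates with constant coefficients, the values of `α` on
  -- the dual frame at `x`.
  set g : M → ℝ := fun y => ∑ i, (α : Cotangent n x) (Z i x) * ξ i y with hg
  have hgs : ContMDiffOn (𝓡 n) 𝓘(ℝ, ℝ) ∞ g W :=
    contMDiffOn_finsetSum fun i _ => contMDiffOn_const.mul (hξ i)
  have hdg : ∀ y ∈ W, ∀ v, mvfderiv (𝓡 n) g y v =
      ∑ i, (α : Cotangent n x) (Z i x) * mvfderiv (𝓡 n) (ξ i) y v := by
    intro y hy v
    rw [hg, mvfderiv_sum_const_mul _ _ fun i _ =>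
      ((hξ i).contMDiffAt (hW.mem_nhds hy)).mdifferentiableAt (by simp),
      sum_apply]
    rfl
  -- The function must be global, since tameness concerns vector fields on all of `M`; a bump
  -- function equal to 1 near `x` leaves its germ unchanged.
  obtain ⟨ρ, -, hρ⟩ := (SmoothBumpFunction.nhds_basis_tsupport (I := 𝓡 n) x).mem_iff.1
    (hW.mem_nhds hxW)
  have hρg : (fun y => ρ y • g y) =ᶠ[𝓝 x] g := by
    filter_upwards [ρ.eventuallyEq_one] with y hy
    simp [hy]
  obtain ⟨V, hV, hVo, hxV⟩ := eventually_nhds_iff.1 hρg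
  have hd : ∀ y ∈ V, mvfderiv (𝓡 n) (fun y => ρ y • g y) y = mvfderiv (𝓡 n) g y := fun y hy =>
    mvfderiv_congr (Filter.eventuallyEq_of_mem (hVo.mem_nhds hy) hV)
  refine ⟨⟨fun y => ρ y • g y, ?_⟩, ?_, V ∩ W, hVo.inter hW, ⟨hxV, hxW⟩, fun y hy v hv => ?_⟩
  · refine contMDiff_of_tsupport fun y hy => ?_
    exact ρ.contMDiffAt.smul (hgs.contMDiffAt
      (hW.mem_nhds (hρ (tsupport_smul_subset_left ρ g hy))))
  · refine (hd x hxV).trans ?_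
    ext v
    rw [hdg x hxW, ← E.conormal_proj α v,
      E.proj_eq_sum (hF x hxW) (hZE x hxW) (hξZ x hxW), map_sum]
    refine Finset.sum_congr rfl fun i _ => ?_
    rw [map_smul, smul_eq_mul, mul_comm]
  · refine (congrArg (fun L => L v) (hd y hy.1)).trans ?_
    rw [hdg y hy.2]
    refine Finset.sum_eq_zero fun i _ => ?_
    rw [(hF y hy.2 v).1 hv i, mul_zero]

end Complement
end Foliation

/-! ### Basic functions and their differentials. -/

namespace Foliation

variable {n p : ℕ} {M : Type*} [TopologicalSpace M] [ChartedSpace (EuclideanSpace ℝ (Fin n)) M]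
  [IsManifold (𝓡 n) ∞ M] {F : Foliation n p M}

/-- `f` is constant along the leaves on `U`. -/
def IsBasicOn (F : Foliation n p M) (U : Set M) (f : M → ℝ) : Prop :=
  ∀ x ∈ U, ∀ v ∈ F.tangent x, mvfderiv (𝓡 n) f x v = 0

theorem IsBasicOn.mono {U V : Set M} {f : M → ℝ} (hf : F.IsBasicOn U f) (hVU : V ⊆ U) :
    F.IsBasicOn V f := fun x hx => hf x (hVU hx)

theorem IsBasicOn.dPrime_eq {U : Set M} {f : M → ℝ} (hf : F.IsBasicOn U f) (E : F.Complement)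
    {x : M} (hx : x ∈ U) : (E.dPrime f x : Cotangent n x) = mvfderiv (𝓡 n) f x := by
  rw [E.dPrime_eq_pull]
  exact congrArg Subtype.val (E.pull_conormal ⟨mvfderiv (𝓡 n) f x, hf x hx⟩)

/-- On `U` the form `d'f` is `df`, so this is `d(df) = 0`, that is, the commutator formula for the
bracket. -/
theorem IsBasicOn.extDerivForm_dPrime {U : Set M} (hU : IsOpen U) {f : M → ℝ}
    (hf : F.IsBasicOn U f) (hfs : ContMDiffOn (𝓡 n) 𝓘(ℝ, ℝ) ∞ f U) (E : F.Complement)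
    {V Y : ∀ x : M, TangentSpace (𝓡 n) x} (hV : SmoothField U V) (hY : SmoothField U Y)
    {x : M} (hx : x ∈ U) :
    extDerivForm (fun y => (E.dPrime f y : Cotangent n y)) V Y x = 0 := by
  have h1 : ∀ Y : ∀ x : M, TangentSpace (𝓡 n) x,
      mvfderiv (𝓡 n) (fun y => (E.dPrime f y : Cotangent n y) (Y y)) x =
        mvfderiv (𝓡 n) (fun y => mvfderiv (𝓡 n) f y (Y y)) x := fun Y =>
    mvfderiv_congr <| Filter.eventuallyEq_of_mem (hU.mem_nhds hx) fun y hy => by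
      simp only [hf.dPrime_eq E hy]
  rw [extDerivForm, h1, h1, hf.dPrime_eq E hx, mvfderiv_mlieBracket
    (hfs.contMDiffAt (hU.mem_nhds hx)) (mdifferentiableAt_of_smoothField hU hV hx)
    (mdifferentiableAt_of_smoothField hU hY hx), sub_self]

theorem Complement.smoothForm_dPrime (E : F.Complement) {U : Set M} (hU : IsOpen U) {f : M → ℝ}
    (hfs : ContMDiffOn (𝓡 n) 𝓘(ℝ, ℝ) ∞ f U) :
    SmoothForm U (fun x => (E.dPrime f x : Cotangent n x)) :=
  E.smoothForm_pull hU (smoothForm_mvfderiv hU hfs)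

theorem IsBasicOn.isFoliatedForm_dPrime {U : Set M} (hU : IsOpen U) {f : M → ℝ}
    (hf : F.IsBasicOn U f) (hfs : ContMDiffOn (𝓡 n) 𝓘(ℝ, ℝ) ∞ f U) (E : F.Complement) :
    F.IsFoliatedForm U (E.dPrime f) :=
  ⟨E.smoothForm_dPrime hU hfs,
    fun _ _ hV hY _ _ hx => hf.extDerivForm_dPrime hU hfs E hV hY hx⟩

/-! ### Hamiltonian fields and the Jacobi identity. -/

namespace Morphism

variable {h : F.Morphism} (E : F.Complement)

/-- The hypothesis concerns foliated forms only, but each conormal covector is the value of one,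
namely the differential of a basic function. -/
theorem IsHamiltonian.skew_apply [T2Space M] (E : F.Complement) (hh : h.IsHamiltonian) {x : M}
    (α β : F.conormal x) :
    (α : Cotangent n x) (h.toFun x β) = -(β : Cotangent n x) (h.toFun x α) := by
  obtain ⟨f, hf, U, hU, hxU, hfU⟩ := E.exists_basic_function x α
  obtain ⟨g, hg, V, hV, hxV, hgV⟩ := E.exists_basic_function x β
  have hfb : F.IsBasicOn (U ∩ V) f := IsBasicOn.mono hfU Set.inter_subset_left
  have hgb : F.IsBasicOn (U ∩ V) g := IsBasicOn.mono hgV Set.inter_subset_right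
  have h1 := hh.skew (U ∩ V) (hU.inter hV) (E.dPrime f) (E.dPrime g)
    (hfb.isFoliatedForm_dPrime (hU.inter hV) f.contMDiff.contMDiffOn E)
    (hgb.isFoliatedForm_dPrime (hU.inter hV) g.contMDiff.contMDiffOn E) x ⟨hxU, hxV⟩
  have h2 : E.dPrime f x = α := by rw [E.dPrime_eq_pull, hf, E.pull_conormal]
  have h3 : E.dPrime g x = β := by rw [E.dPrime_eq_pull, hg, E.pull_conormal]
  rwa [h2, h3] at h1

theorem smoothField_hamField (h : F.Morphism) {U : Set M} (hU : IsOpen U) {f : M → ℝ}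
    (hf : ContMDiffOn (𝓡 n) 𝓘(ℝ, ℝ) ∞ f U) : SmoothField U (h.hamField E f) :=
  h.smooth U hU _ (E.smoothForm_dPrime hU hf)

theorem contMDiff_extBracket (h : F.Morphism) {f g : M → ℝ} (hf : ContMDiff (𝓡 n) 𝓘(ℝ, ℝ) ∞ f)
    (hg : ContMDiff (𝓡 n) 𝓘(ℝ, ℝ) ∞ g) : ContMDiff (𝓡 n) 𝓘(ℝ, ℝ) ∞ (h.extBracket E f g) := by
  rw [← contMDiffOn_univ] at hf hg ⊢
  exact (smoothForm_mvfderiv isOpen_univ hg).apply (h.smoothField_hamField E isOpen_univ hf)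

/-- For `V` tangent to the leaves, `V(X'_f g) = X'_f(Vg) - [X'_f,V]g`. Here `Vg = 0`, and `[X'_f,V]`
is tangent because `X'_f` is foliated. -/
theorem IsHamiltonian.isBasicOn_extBracket (hh : h.IsHamiltonian) {U : Set M} (hU : IsOpen U)
    {f g : M → ℝ} (hf : F.IsBasicOn U f) (hg : F.IsBasicOn U g)
    (hfs : ContMDiff (𝓡 n) 𝓘(ℝ, ℝ) ∞ f) (hgs : ContMDiff (𝓡 n) 𝓘(ℝ, ℝ) ∞ g) :
    F.IsBasicOn U (h.extBracket E f g) := by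
  intro x hx v hv
  obtain ⟨W, hW, hxW, V, hV, rfl, hVF⟩ := E.exists_tangent_field hv
  have hWU : IsOpen (W ∩ U) := hW.inter hU
  have hxWU : x ∈ W ∩ U := ⟨hxW, hx⟩
  have hV' : SmoothField (W ∩ U) V := hV.mono Set.inter_subset_left
  have h1 := (hh.foliated (W ∩ U) hWU (E.dPrime f)
    ((hf.mono Set.inter_subset_right).isFoliatedForm_dPrime hWU hfs.contMDiffOn E)).2 V hV'
    (fun y _ => hVF y) x hxWU
  have h2 := mvfderiv_mlieBracket hgs.contMDiffAt
    (mdifferentiableAt_of_smoothField hWU (h.smoothField_hamField E hWU hfs.contMDiffOn) hxWU)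
    (mdifferentiableAt_of_smoothField hWU hV' hxWU)
  have h3 : mvfderiv (𝓡 n) (fun y => mvfderiv (𝓡 n) g y (V y)) x = 0 := by
    rw [mvfderiv_congr (g := fun _ => (0 : ℝ)) (Filter.eventuallyEq_of_mem (hU.mem_nhds hx)
      fun y hy => hg y hy _ (hVF y)), mvfderiv_const]
  have h4 := hg x hx _ h1
  rw [h3, zero_apply, zero_sub] at h2
  exact neg_eq_zero.1 (h2.symm.trans h4)

/-- In Cartan's formula the term with `d(d'g)` vanishes, leaving `d{f,g}'`. This equals `d'{f,g}'`
because the bracket is basic. -/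
theorem IsHamiltonian.isLieDerivForm_dPrime (hh : h.IsHamiltonian) {U : Set M} (hU : IsOpen U)
    {f g : M → ℝ} (hf : F.IsBasicOn U f) (hg : F.IsBasicOn U g)
    (hfs : ContMDiff (𝓡 n) 𝓘(ℝ, ℝ) ∞ f) (hgs : ContMDiff (𝓡 n) 𝓘(ℝ, ℝ) ∞ g) :
    IsLieDerivForm U (fun x => h.toFun x (E.dPrime f x))
      (fun x => (E.dPrime g x : Cotangent n x))
      (fun x => (E.dPrime (h.extBracket E f g) x : Cotangent n x)) := by
  intro Y hY x hx
  have h1 := hg.extDerivForm_dPrime hU hgs.contMDiffOn E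
    (h.smoothField_hamField E hU hfs.contMDiffOn) hY hx
  have h2 : mvfderiv (𝓡 n) (fun y => (E.dPrime g y : Cotangent n y) (h.toFun y (E.dPrime f y))) x =
      mvfderiv (𝓡 n) (h.extBracket E f g) x :=
    mvfderiv_congr <| Filter.eventuallyEq_of_mem (hU.mem_nhds hx) fun y hy => by
      simp only [hg.dPrime_eq E hy]
      rfl
  dsimp only
  rw [(hh.isBasicOn_extBracket E hU hf hg hfs hgs).dPrime_eq E hx, h2]
  exact (add_eq_left.2 h1).symm

theorem IsImageExtension.hamField_mem (hE : h.IsImageExtension E) (f : M → ℝ) (x : M) :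
    h.hamField E f x ∈ E.dist x := hE x (LinearMap.mem_range_self _ _)

theorem IsImageExtension.extBracket_eq (hE : h.IsImageExtension E) (f g : M → ℝ) (x : M) :
    h.extBracket E f g x = (E.dPrime g x : Cotangent n x) (h.toFun x (E.dPrime f x)) :=
  (E.pull_of_mem _ (hE.hamField_mem E f x)).symm

variable {E}

theorem IsTame.extBracket_skew [T2Space M] (hE : h.IsTame E) (f g : M → ℝ) :
    h.extBracket E f g = fun x => -h.extBracket E g f x := by
  ext x
  rw [hE.isImageExtension.extBracket_eq, hE.isImageExtension.extBracket_eq,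
    hE.isHamiltonian.skew_apply E]

theorem IsTame.jacobi_of_isBasicOn (hE : h.IsTame E) {U : Set M} (hU : IsOpen U)
    {f g k : M → ℝ} (hf : F.IsBasicOn U f) (hg : F.IsBasicOn U g) (hk : F.IsBasicOn U k)
    (hfs : ContMDiff (𝓡 n) 𝓘(ℝ, ℝ) ∞ f) (hgs : ContMDiff (𝓡 n) 𝓘(ℝ, ℝ) ∞ g)
    (hks : ContMDiff (𝓡 n) 𝓘(ℝ, ℝ) ∞ k) {x : M} (hx : x ∈ U) :
    h.extBracket E (h.extBracket E f g) k x + h.extBracket E (h.extBracket E g k) f x +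
      h.extBracket E (h.extBracket E k f) g x = 0 := by
  have hh := hE.isHamiltonian
  have h1 := hh.poisson U hU _ _ _
    (hf.isFoliatedForm_dPrime hU hfs.contMDiffOn E) (hg.isFoliatedForm_dPrime hU hgs.contMDiffOn E)
    (hk.isFoliatedForm_dPrime hU hks.contMDiffOn E) _ _ _
    (hh.isLieDerivForm_dPrime E hU hf hg hfs hgs) (hh.isLieDerivForm_dPrime E hU hg hk hgs hks)
    (hh.isLieDerivForm_dPrime E hU hk hf hks hfs) x hx
  simp only [← hE.isImageExtension.extBracket_eq] at h1
  linarith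

/-- The Jacobiator of `f`, `g`, `k` is the derivative of `k` along a vector of `E` that depends on
`f` and `g` only. -/
theorem IsTame.exists_jacobiator_eq [T2Space M] (hE : h.IsTame E) {f g : M → ℝ}
    (hfs : ContMDiff (𝓡 n) 𝓘(ℝ, ℝ) ∞ f) (hgs : ContMDiff (𝓡 n) 𝓘(ℝ, ℝ) ∞ g) (x : M) :
    ∃ w ∈ E.dist x, ∀ k : M → ℝ, ContMDiff (𝓡 n) 𝓘(ℝ, ℝ) ∞ k →
      h.extBracket E (h.extBracket E f g) k x + h.extBracket E (h.extBracket E g k) f x +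
        h.extBracket E (h.extBracket E k f) g x = mvfderiv (𝓡 n) k x w := by
  have hX := h.smoothField_hamField E isOpen_univ hfs.contMDiffOn
  have hY := h.smoothField_hamField E isOpen_univ hgs.contMDiffOn
  -- This `w` measures the failure of `f ↦ X'_f` to preserve brackets. Expanding `[X'_f, X'_g]k` and
  -- using skew-symmetry turns `dk(w)` into the Jacobiator.
  refine ⟨h.hamField E (h.extBracket E f g) x -
    VectorField.mlieBracket (𝓡 n) (h.hamField E f) (h.hamField E g) x,
    Submodule.sub_mem _ (hE.isImageExtension.hamField_mem E _ x)
      (hE.bracket_mem _ _ hX hY (fun y => LinearMap.mem_range_self _ _)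
        (fun y => LinearMap.mem_range_self _ _) x), fun k hk => ?_⟩
  rw [map_sub, mvfderiv_mlieBracket hk.contMDiffAt
    (mdifferentiableAt_of_smoothField isOpen_univ hX trivial)
    (mdifferentiableAt_of_smoothField isOpen_univ hY trivial),
    congrFun (hE.extBracket_skew (h.extBracket E g k) f) x,
    congrFun (hE.extBracket_skew (h.extBracket E k f) g) x, hE.extBracket_skew k f]
  have h1 : h.extBracket E g (fun y => -h.extBracket E f k y) x =
      -h.extBracket E g (h.extBracket E f k) x := by
    unfold extBracket
    rw [mvfderiv_fun_neg]
    rfl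
  have h2 : ∀ f : M → ℝ, (fun y => mvfderiv (𝓡 n) k y (h.hamField E f y)) = h.extBracket E f k :=
    fun _ => rfl
  rw [h1, h2, h2]
  simp only [extBracket]
  ring

/-- At `x` each function may be exchanged for one that is basic near `x` and whose differential is
the `d'` of the original. -/
theorem IsTame.jacobi [T2Space M] (hE : h.IsTame E) {f g k : M → ℝ}
    (hfs : ContMDiff (𝓡 n) 𝓘(ℝ, ℝ) ∞ f) (hgs : ContMDiff (𝓡 n) 𝓘(ℝ, ℝ) ∞ g)
    (hks : ContMDiff (𝓡 n) 𝓘(ℝ, ℝ) ∞ k) (x : M) :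
    h.extBracket E (h.extBracket E f g) k x + h.extBracket E (h.extBracket E g k) f x +
      h.extBracket E (h.extBracket E k f) g x = 0 := by
  have hreplace : ∀ {f g k k' : M → ℝ}, ContMDiff (𝓡 n) 𝓘(ℝ, ℝ) ∞ f →
      ContMDiff (𝓡 n) 𝓘(ℝ, ℝ) ∞ g → ContMDiff (𝓡 n) 𝓘(ℝ, ℝ) ∞ k →
      ContMDiff (𝓡 n) 𝓘(ℝ, ℝ) ∞ k' →
      mvfderiv (𝓡 n) k' x = E.dPrime k x →
      h.extBracket E (h.extBracket E f g) k x + h.extBracket E (h.extBracket E g k) f x +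
        h.extBracket E (h.extBracket E k f) g x =
      h.extBracket E (h.extBracket E f g) k' x + h.extBracket E (h.extBracket E g k') f x +
        h.extBracket E (h.extBracket E k' f) g x := by
    intro f g k k' hf hg hk hk' hkk'
    obtain ⟨w, hw, hJ⟩ := hE.exists_jacobiator_eq hf hg x
    rw [hJ k hk, hJ k' hk', hkk', E.dPrime_eq_pull, E.pull_of_mem _ hw]
  obtain ⟨f', hf', U, hU, hxU, hfU⟩ := E.exists_basic_function x (E.dPrime f x)
  obtain ⟨g', hg', V, hV, hxV, hgV⟩ := E.exists_basic_function x (E.dPrime g x)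
  obtain ⟨k', hk', W, hW, hxW, hkW⟩ := E.exists_basic_function x (E.dPrime k x)
  -- Only the last argument can be exchanged, so the triple is rotated cyclically between the three
  -- replacements.
  have h1 := hreplace hfs hgs hks k'.contMDiff hk'
  have h2 := hreplace hgs k'.contMDiff hfs f'.contMDiff hf'
  have h3 := hreplace k'.contMDiff f'.contMDiff hgs g'.contMDiff hg'
  have h4 := hE.jacobi_of_isBasicOn (U := U ∩ (V ∩ W)) (hU.inter (hV.inter hW))
    (IsBasicOn.mono hfU fun y hy => hy.1) (IsBasicOn.mono hgV fun y hy => hy.2.1)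
    (IsBasicOn.mono hkW fun y hy => hy.2.2) f'.contMDiff g'.contMDiff k'.contMDiff
    ⟨hxU, hxV, hxW⟩
  linarith

/-! ### The Poisson bracket and its bivector field. -/

/-- The bracket `{f,g}'` as a bilinear map on `C^∞(M)`. -/
def extBracketBilin (h : F.Morphism) (E : F.Complement) :
    C^∞⟮𝓡 n, M; ℝ⟯ →ₗ[ℝ] C^∞⟮𝓡 n, M; ℝ⟯ →ₗ[ℝ] C^∞⟮𝓡 n, M; ℝ⟯ :=
  LinearMap.mk₂ ℝ (fun f g => ⟨h.extBracket E f g, h.contMDiff_extBracket E f.contMDiff g.contMDiff⟩)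
    (fun f₁ f₂ g => by
      ext x
      change mvfderiv (𝓡 n) g x (h.toFun x (E.pull x (mvfderiv (𝓡 n) (f₁ + f₂ : M → ℝ) x))) = _
      rw [mvfderiv_add f₁.mdifferentiableAt f₂.mdifferentiableAt, map_add, map_add, map_add]
      rfl)
    (fun c f g => by
      ext x
      change mvfderiv (𝓡 n) g x (h.toFun x (E.pull x (mvfderiv (𝓡 n) (c • f : M → ℝ) x))) = _
      rw [mvfderiv_const_smul c f.mdifferentiableAt, map_smul, map_smul, map_smul]
      rfl)
    (fun f g₁ g₂ => by
      ext x
      change mvfderiv (𝓡 n) (g₁ + g₂ : M → ℝ) x _ = _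
      rw [mvfderiv_add g₁.mdifferentiableAt g₂.mdifferentiableAt]
      rfl)
    (fun c f g => by
      ext x
      change mvfderiv (𝓡 n) (c • g : M → ℝ) x _ = _
      rw [mvfderiv_const_smul c g.mdifferentiableAt]
      rfl)

theorem IsTame.isPoissonBracket [T2Space M] (hE : h.IsTame E) :
    IsPoissonBracket (h.extBracketBilin E) where
  skew f g := by
    ext x
    exact congrFun (hE.extBracket_skew f g) x
  leibniz f g k := by
    ext x
    change mvfderiv (𝓡 n) (g * k : M → ℝ) x _ =
      mvfderiv (𝓡 n) g x _ * k x + g x * mvfderiv (𝓡 n) k x _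
    rw [mvfderiv_mul g.mdifferentiableAt k.mdifferentiableAt]
    simp only [add_apply, smul_apply, smul_eq_mul]
    ring
  jacobi f g k := by
    ext x
    exact hE.jacobi f.contMDiff g.contMDiff k.contMDiff x

/-- The bivector field `P(α,β) = ⟨H(α ∘ p_E), β⟩` of a tame hamiltonian structure. -/
def IsTame.bivector [T2Space M] (hE : h.IsTame E) : BivectorField n M where
  toFun x := LinearMap.mk₂ ℝ (fun α β => β (h.toFun x (E.pull x α)))
    (fun α₁ α₂ β => by rw [map_add, map_add, map_add])
    (fun c α β => by rw [map_smul, map_smul, map_smul])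
    (fun α β₁ β₂ => rfl) (fun c α β => rfl)
  skew x α β := by
    have h1 : ∀ α β : Cotangent n x, β (h.toFun x (E.pull x α)) =
        (E.pull x β : Cotangent n x) (h.toFun x (E.pull x α)) := fun α β =>
      (E.pull_of_mem β (hE.isImageExtension x (LinearMap.mem_range_self _ _))).symm
    simp only [LinearMap.mk₂_apply]
    rw [h1 α β, h1 β α, hE.isHamiltonian.skew_apply E]
  smooth U hU α β hα hβ := hβ.apply (h.smooth U hU _ (E.smoothForm_pull hU hα))

theorem IsTame.sharp_bivector [T2Space M] (hE : h.IsTame E) (x : M) (α : Cotangent n x) :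
    hE.bivector.sharp x α = h.toFun x (E.pull x α) := by
  rw [BivectorField.sharp, LinearEquiv.symm_apply_eq]
  rfl

end Morphism
end Foliation
end HamFol

end

theorem proposition3p2 {n p : ℕ} {M : Type*} [TopologicalSpace M] [T2Space M]
    [ChartedSpace (EuclideanSpace ℝ (Fin n)) M] [IsManifold (𝓡 n) ∞ M]
    (F : HamFol.Foliation n p M) (h : F.Morphism) (E : F.Complement) (hE : h.IsTame E) :
    (∃ B : C^∞⟮𝓡 n, M; ℝ⟯ →ₗ[ℝ] C^∞⟮𝓡 n, M; ℝ⟯ →ₗ[ℝ] C^∞⟮𝓡 n, M; ℝ⟯,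
      (∀ (f g : C^∞⟮𝓡 n, M; ℝ⟯) (x : M), B f g x = h.extBracket E f g x) ∧
        HamFol.IsPoissonBracket B) ∧
    ∃ P : HamFol.BivectorField n M, P.IsPoisson ∧
      (∀ (f g : C^∞⟮𝓡 n, M; ℝ⟯) (x : M),
        P.toFun x (mvfderiv (𝓡 n) f x) (mvfderiv (𝓡 n) g x) = h.extBracket E f g x) ∧
      (∀ (x : M) (α : F.conormal x), P.sharp x α = h.toFun x α) ∧
      (∀ (x : M) (α : HamFol.Cotangent n x), (∀ v ∈ E.dist x, α v = 0) → P.sharp x α = 0) := by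
  refine ⟨⟨h.extBracketBilin E, fun _ _ _ => rfl, hE.isPoissonBracket⟩, hE.bivector,
    ⟨h.extBracketBilin E, fun _ _ _ => rfl, hE.isPoissonBracket⟩, fun _ _ _ => rfl,
    fun x α => ?_, fun x α hα => ?_⟩
  · rw [hE.sharp_bivector, E.pull_conormal]
  -- A covector that annihilates `E` vanishes after composition with `p_E`, whose values lie in `E`.
  · have h0 : E.pull x α = 0 :=
      Subtype.ext (ContinuousLinearMap.ext fun v => hα _ (E.proj_mem x v))
    rw [hE.sharp_bivector, h0, map_zero]
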